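/- Let $\mathbb N=\{1,2,\dots\}$ and $\mathbb Z^*=\mathbb Z\setminus\{0\}$. Let $\Sigma=\{\alpha_n: n\in\mathbb Z^*\}$ be an alphabet, $\vec k=(k_n)_{n\in\mathbb Z^*}\subseteq\mathbb N$ with $(k_n)_{n\in\mathbb N}$ and $(k_{-n})_{n\in\mathbb N}$ increasing (not necessarily strictly), and $\upsilon\notin\Sigma$ a variable. (In the "resp." case only $\alpha_n,k_n$ with $n\in\mathbb N$ are needed.) **Words.** Consider functions $w$ from a non-empty finite set $dom(w)\subseteq\mathbb Z^*$ to $\Sigma\cup\{\upsilon\}$ with $w_n\in\{\upsilon,\alpha_1,\dots,\alpha_{k_n}\}$ for $n>0$ and $w_n\in\{\upsilon,\alpha_{-1},\dots,\alpha_{-k_n}\}$ for $n<0$. $\widetilde L(\Sigma,\vec k)$ is the set of those in which $\upsilon$ does not occur, $\widetilde L_0(\Sigma,\vec k;\upsilon)$ the set of those with $\upsilon$ occurring both at a negative and at a positive place. $L(\Sigma,\vec k)$ and $L(\Sigma,\vec k;\upsilon)$ are the sets of those with $dom(w)\subseteq\mathbb N$ in which $\upsilon$ does not occur, respectively occurs.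 Put $dom^\pm(w)=\{n\in dom(w):\pm n>0\}$. For words with disjoint domains $w\star u$ is the common extension to $dom(w)\cup dom(u)$. Write $w<_{R_1}u$ if $dom(u)=A_1\cup A_2$ with $A_1,A_2\ne\emptyset$ and $\max A_1<\min dom(w)\le\max dom(w)<\min A_2$, and $w<_{R_2}u$ if $\max dom(w)<\min dom(u)$. Let $\widetilde L^\infty(\Sigma,\vec k;\upsilon)$ (resp. $L^\infty(\Sigma,\vec k;\upsilon)$) be the set of sequences $(w_n)_{n\in\mathbb N}$ in $\widetilde L_0(\Sigma,\vec k;\upsilon)$ with $w_n<_{R_1}w_{n+1}$ for all $n$ (resp. in $L(\Sigma,\vec k;\upsilon)$ with $w_n<_{R_2}w_{n+1}$ for all $n$). **Extractions.** $w(p,q)$ is obtained from $w$ by replacing $\upsilon$ with $\alpha_p$ at positive places and with $\alpha_{-q}$ at negative places, and $w(\upsilon,\upsilon)=w$ (resp. $w(p)$ by replacing $\upsilon$ with $\alpha_p$, and $w(\upsilon)=w$). For $\vec w=(w_n)_{n\in\mathbb N}$, $\widetilde E(\vec w)$ is the set of the words $w_{n_1}(p_1,q_1)\star\dots\star w_{n_\lambda}(p_\lambda,q_\lambda)\in\widetilde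 L(\Sigma,\vec k)$ with $\lambda\ge1$, $n_1<\dots<n_\lambda$ in $\mathbb N$, $1\le p_i\le k_{n_i}$ and $1\le q_i\le k_{-n_i}$. $\widetilde{EV}(\vec w)$ is the set of the words of this form in $\widetilde L_0(\Sigma,\vec k;\upsilon)$ where also $(p_i,q_i)=(\upsilon,\upsilon)$ is allowed and occurs for at least one $i$. (Resp. $E(\vec w)\subseteq L(\Sigma,\vec k)$ and $EV(\vec w)\subseteq L(\Sigma,\vec k;\upsilon)$ are defined in the same way from the words $w_{n_1}(p_1)\star\dots\star w_{n_\lambda}(p_\lambda)$ with $1\le p_i\le k_{n_i}$, or $p_i=\upsilon$.) $\vec u\prec\vec w$ means that $\vec u\in\widetilde L^\infty(\Sigma,\vec k;\upsilon)$ and all $u_n\in\widetilde{EV}(\vec w)$ (resp. $\vec u\in L^\infty(\Sigma,\vec k;\upsilon)$ and all $u_n\in EV(\vec w)$). **Limits and systems.** $R_1\text{-}\lim_{w\in\widetilde E(\vec u)}x_w=x_0$ means that for every neighbourhood $V$ of $x_0$ there is $n_0\in\mathbb N$ with $x_w\in V$ for all $w\in\widetilde E(\vec u)$ with $\min\{-\max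 dom^-(w),\min dom^+(w)\}\ge n_0$; $R_2\text{-}\lim_{w\in E(\vec u)}x_w=x_0$ means the same for all $w\in E(\vec u)$ with $\min dom(w)\ge n_0$. An $\widetilde L(\Sigma,\vec k)$-system (resp. $L(\Sigma,\vec k)$-system) of a topological space $X$ is a family $(T^w)$ of continuous maps $X\to X$ indexed by $w\in\widetilde L(\Sigma,\vec k)$ (resp. $w\in L(\Sigma,\vec k)$) with $T^{w_1}\circ T^{w_2}=T^{w_1\star w_2}$ whenever $w_1<_{R_1}w_2$ (resp. $w_1<_{R_2}w_2$). **Theorem.** Let $(T^w)$ be an $\widetilde L(\Sigma,\vec k)$-system (resp. $L(\Sigma,\vec k)$-system) of a compact metric space $X$, let $\vec w\in\widetilde L^\infty(\Sigma,\vec k;\upsilon)$ (resp. $\vec w\in L^\infty(\Sigma,\vec k;\upsilon)$) and $x\in X$. Then there are an extraction $\vec u\prec\vec w$ and a point $x_0\in X$ such that $$R_1\text{-}\lim_{w\in\widetilde E(\vec u)}T^w(x)=x_0\quad\text{and}\quad R_1\text{-}\lim_{w\in\widetilde E(\vec u)}T^w(x_0)=x_0$$ $$\Big(\text{resp. } R_2\text{-}\lim_{w\in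 E(\vec u)}T^w(x)=x_0\quad\text{and}\quad R_2\text{-}\lim_{w\in E(\vec u)}T^w(x_0)=x_0\Big).$$ -/

import Mathlib

open Topology

/-- Symbols over the letters `A`: a letter of the alphabet, or the variable `υ`
(which is therefore never a letter). -/
inductive LSym (A : Type*) where
  | letter (a : A) : LSym A
  | var : LSym A

/-- A located word: a function from a finite set of integers (its domain) to symbols.
It is encoded as a map `ℤ → Option (LSym A)` that equals `none` outside the domain, so that two
words are equal iff they have the same domain and the same values on it. -/
@[ext]
structure LocWord (A : Type*) where
  toFun : ℤ → Option (LSym A)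
  finite_dom : {n : ℤ | toFun n ≠ none}.Finite

namespace LocWord

variable {A : Type*}

/-- The domain of a word. -/
def dom (w : LocWord A) : Set ℤ := {n | w.toFun n ≠ none}

/-- The word with empty domain; only the neutral starting value for iterated concatenation. -/
def empty : LocWord A where
  toFun := fun _ => none
  finite_dom := by simp

/-- Concatenation `w ⋆ u`: the union of the two functions (used for disjoint domains only). -/
def conc (w u : LocWord A) : LocWord A where
  toFun := fun n => (w.toFun n).or (u.toFun n)
  finite_dom := by
    refine (w.finite_dom.union u.finite_dom).subset ?_
    intro n hn
    by_cases h : w.toFun n = none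
    · exact Or.inr fun h' => hn (by simp [h, h'])
    · exact Or.inl h

/-- `{α_1, …, α_{k_n}}` if `n > 0`, and `{α_{-k_n}, …, α_{-1}}` if `n < 0`. -/
def lettersAt (α : ℤ → A) (k : ℤ → ℕ) (n : ℤ) : Set A :=
  {a | ∃ j : ℕ, 1 ≤ j ∧ j ≤ k n ∧
    ((0 < n ∧ a = α (j : ℤ)) ∨ (n < 0 ∧ a = α (-(j : ℤ))))}

/-- The constant and the variable `ω`-`ℤ*`-located words over `Σ = {α_n}` dominated by `k`:
`L~(Σ ∪ {υ}, k)`. -/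
def LtAll (α : ℤ → A) (k : ℤ → ℕ) : Set (LocWord A) :=
  {w | w.dom.Nonempty ∧ (0 : ℤ) ∉ w.dom ∧
    ∀ (n : ℤ) (a : A), w.toFun n = some (LSym.letter a) → a ∈ lettersAt α k n}

/-- The constant words `L~(Σ, k)`. -/
def Lt (α : ℤ → A) (k : ℤ → ℕ) : Set (LocWord A) :=
  {w | w ∈ LtAll α k ∧ ∀ n, w.toFun n ≠ some LSym.var}

/-- The words `L~_0(Σ, k; υ)`: the variable occurs at a negative and at a positive place. -/
def Lt0 (α : ℤ → A) (k : ℤ → ℕ) : Set (LocWord A) :=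
  {w | w ∈ LtAll α k ∧ (∃ n < 0, w.toFun n = some LSym.var) ∧ ∃ n > 0, w.toFun n = some LSym.var}

/-- The constant `ω`-located words `L(Σ, k)`: all places are positive. Only `α_n` and `k_n` with
`n ≥ 1` matter. -/
def Lp (α : ℤ → A) (k : ℤ → ℕ) : Set (LocWord A) :=
  {w | w ∈ Lt α k ∧ ∀ n ∈ w.dom, 0 < n}

/-- The variable `ω`-located words `L(Σ, k; υ)`. -/
def LpVar (α : ℤ → A) (k : ℤ → ℕ) : Set (LocWord A) :=
  {w | w ∈ LtAll α k ∧ (∀ n ∈ w.dom, 0 < n) ∧ ∃ n, w.toFun n = some LSym.var}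

/-- The relation `w <_{R₁} u`. -/
def R1 (w u : LocWord A) : Prop :=
  ∃ A₁ A₂ : Set ℤ, A₁.Nonempty ∧ A₂.Nonempty ∧ u.dom = A₁ ∪ A₂ ∧
    (∀ a ∈ A₁, ∀ n ∈ w.dom, a < n) ∧ ∀ n ∈ w.dom, ∀ a ∈ A₂, n < a

/-- The relation `w <_{R₂} u`. -/
def R2 (w u : LocWord A) : Prop :=
  ∀ n ∈ w.dom, ∀ m ∈ u.dom, n < m

/-- `L~^∞(Σ, k; υ)`. Sequences are indexed by `1, 2, …`; the entry at `0` is never used. -/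
def LtInf (α : ℤ → A) (k : ℤ → ℕ) : Set (ℕ → LocWord A) :=
  {w | ∀ n, 1 ≤ n → w n ∈ Lt0 α k ∧ R1 (w n) (w (n + 1))}

/-- `L^∞(Σ, k; υ)`. Sequences are indexed by `1, 2, …`; the entry at `0` is never used. -/
def LpInf (α : ℤ → A) (k : ℤ → ℕ) : Set (ℕ → LocWord A) :=
  {w | ∀ n, 1 ≤ n → w n ∈ LpVar α k ∧ R2 (w n) (w (n + 1))}

/-- The effect of replacing the variable by the letter `a`. -/
def fillSym (a : A) : LSym A → LSym A
  | LSym.letter b => LSym.letter b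
  | LSym.var => LSym.letter a

/-- Substitution of the letter `f n` for the variable at every place `n` where it occurs. -/
def fill (f : ℤ → A) (w : LocWord A) : LocWord A where
  toFun := fun n => (w.toFun n).map (fillSym (f n))
  finite_dom := by
    refine w.finite_dom.subset ?_
    intro n hn h
    exact hn (by simp [h])

/-- `w(p, q)` for `c = some (p, q)` (`α_p` at positive, `α_{-q}` at negative places), and
`w(υ, υ) = w` for `c = none`. -/
def subst₂ (α : ℤ → A) (c : Option (ℕ × ℕ)) (w : LocWord A) : LocWord A :=
  match c with
  | none => w
  | some (p, q) => w.fill (fun n => if 0 < n then α (p : ℤ) else α (-(q : ℤ)))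

/-- `w(p)` for `c = some p`, and `w(υ) = w` for `c = none`. -/
def subst₁ (α : ℤ → A) (c : Option ℕ) (w : LocWord A) : LocWord A :=
  match c with
  | none => w
  | some p => w.fill (fun _ => α (p : ℤ))

/-- `w_{n_1}(c_1) ⋆ … ⋆ w_{n_l}(c_l)` for the list of the pairs `(n_i, c_i)`. -/
def prod₂ (α : ℤ → A) (w : ℕ → LocWord A) (l : List (ℕ × Option (ℕ × ℕ))) : LocWord A :=
  (l.map fun e => (w e.1).subst₂ α e.2).foldr conc empty

/-- `w_{n_1}(c_1) ⋆ … ⋆ w_{n_l}(c_l)` for the list of the pairs `(n_i, c_i)`. -/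
def prod₁ (α : ℤ → A) (w : ℕ → LocWord A) (l : List (ℕ × Option ℕ)) : LocWord A :=
  (l.map fun e => (w e.1).subst₁ α e.2).foldr conc empty

/-- Admissible data `(n_1, c_1), …, (n_l, c_l)`: `l ≥ 1`, `1 ≤ n_1 < … < n_l`, and each `c_i` is
`(υ, υ)` or a pair in `{1, …, k_{n_i}} × {1, …, k_{-n_i}}`. -/
def Adm₂ (k : ℤ → ℕ) (l : List (ℕ × Option (ℕ × ℕ))) : Prop :=
  l ≠ [] ∧ l.Pairwise (fun e e' => e.1 < e'.1) ∧
    ∀ e ∈ l, 1 ≤ e.1 ∧ ∀ p q : ℕ, e.2 = some (p, q) →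
      1 ≤ p ∧ p ≤ k (e.1 : ℤ) ∧ 1 ≤ q ∧ q ≤ k (-(e.1 : ℤ))

/-- Admissible data `(n_1, c_1), …, (n_l, c_l)`: `l ≥ 1`, `1 ≤ n_1 < … < n_l`, and each `c_i` is
`υ` or an element of `{1, …, k_{n_i}}`. -/
def Adm₁ (k : ℤ → ℕ) (l : List (ℕ × Option ℕ)) : Prop :=
  l ≠ [] ∧ l.Pairwise (fun e e' => e.1 < e'.1) ∧
    ∀ e ∈ l, 1 ≤ e.1 ∧ ∀ p : ℕ, e.2 = some p → 1 ≤ p ∧ p ≤ k (e.1 : ℤ)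

/-- The extracted words `E~(w)`. -/
def Et (α : ℤ → A) (k : ℤ → ℕ) (w : ℕ → LocWord A) : Set (LocWord A) :=
  {z | z ∈ Lt α k ∧ ∃ l, Adm₂ k l ∧ (∀ e ∈ l, e.2 ≠ none) ∧ z = prod₂ α w l}

/-- The extracted variable words `EV~(w)`. -/
def EVt (α : ℤ → A) (k : ℤ → ℕ) (w : ℕ → LocWord A) : Set (LocWord A) :=
  {u | u ∈ Lt0 α k ∧ ∃ l, Adm₂ k l ∧ (∃ e ∈ l, e.2 = none) ∧ u = prod₂ α w l}

/-- The extracted words `E(w)`. -/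
def Ep (α : ℤ → A) (k : ℤ → ℕ) (w : ℕ → LocWord A) : Set (LocWord A) :=
  {z | z ∈ Lp α k ∧ ∃ l, Adm₁ k l ∧ (∀ e ∈ l, e.2 ≠ none) ∧ z = prod₁ α w l}

/-- The extracted variable words `EV(w)`. -/
def EVp (α : ℤ → A) (k : ℤ → ℕ) (w : ℕ → LocWord A) : Set (LocWord A) :=
  {u | u ∈ LpVar α k ∧ ∃ l, Adm₁ k l ∧ (∃ e ∈ l, e.2 = none) ∧ u = prod₁ α w l}

/-- `u` is an extraction of `w`, for sequences in `L~^∞(Σ, k; υ)`. -/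
def Extraction₂ (α : ℤ → A) (k : ℤ → ℕ) (u w : ℕ → LocWord A) : Prop :=
  u ∈ LtInf α k ∧ ∀ n, 1 ≤ n → u n ∈ EVt α k w

/-- `u` is an extraction of `w`, for sequences in `L^∞(Σ, k; υ)`. -/
def Extraction₁ (α : ℤ → A) (k : ℤ → ℕ) (u w : ℕ → LocWord A) : Prop :=
  u ∈ LpInf α k ∧ ∀ n, 1 ≤ n → u n ∈ EVp α k w

/-- `dom⁻(w)` and `dom⁺(w)` are non-empty and `min {-max dom⁻(w), min dom⁺(w)} ≥ n₀`. -/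
def Far₂ (n₀ : ℕ) (w : LocWord A) : Prop :=
  (∃ n ∈ w.dom, n < 0) ∧ (∃ n ∈ w.dom, 0 < n) ∧
    ∀ n ∈ w.dom, (n < 0 → (n₀ : ℤ) ≤ -n) ∧ (0 < n → (n₀ : ℤ) ≤ n)

/-- `min dom(w) ≥ n₀`. -/
def Far₁ (n₀ : ℕ) (w : LocWord A) : Prop :=
  ∀ n ∈ w.dom, (n₀ : ℤ) ≤ n

/-- `R₁-lim_{w ∈ S} x_w = x₀`. -/
def R1Lim {X : Type*} [TopologicalSpace X] (S : Set (LocWord A)) (x : LocWord A → X) (x₀ : X) :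
    Prop :=
  ∀ V ∈ 𝓝 x₀, ∃ n₀ : ℕ, ∀ w ∈ S, Far₂ n₀ w → x w ∈ V

/-- `R₂-lim_{w ∈ S} x_w = x₀`. -/
def R2Lim {X : Type*} [TopologicalSpace X] (S : Set (LocWord A)) (x : LocWord A → X) (x₀ : X) :
    Prop :=
  ∀ V ∈ 𝓝 x₀, ∃ n₀ : ℕ, ∀ w ∈ S, Far₁ n₀ w → x w ∈ V

/-- `(T^w)_{w ∈ L~(Σ, k)}` is an `L~(Σ, k)`-system of continuous maps of `X`. The values of `T`
outside `L~(Σ, k)` are irrelevant. -/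
def IsLtSystem {X : Type*} [TopologicalSpace X] (α : ℤ → A) (k : ℤ → ℕ)
    (T : LocWord A → X → X) : Prop :=
  (∀ w ∈ Lt α k, Continuous (T w)) ∧
    ∀ w₁ ∈ Lt α k, ∀ w₂ ∈ Lt α k, R1 w₁ w₂ → T w₁ ∘ T w₂ = T (conc w₁ w₂)

/-- `(T^w)_{w ∈ L(Σ, k)}` is an `L(Σ, k)`-system of continuous maps of `X`. The values of `T`
outside `L(Σ, k)` are irrelevant. -/
def IsLpSystem {X : Type*} [TopologicalSpace X] (α : ℤ → A) (k : ℤ → ℕ)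
    (T : LocWord A → X → X) : Prop :=
  (∀ w ∈ Lp α k, Continuous (T w)) ∧
    ∀ w₁ ∈ Lp α k, ∀ w₂ ∈ Lp α k, R2 w₁ w₂ → T w₁ ∘ T w₂ = T (conc w₁ w₂)

/-- `(k_n)_{n ≥ 1}` is an increasing (not necessarily strictly) sequence of positive integers. -/
def PosIncr (k : ℕ → ℕ) : Prop :=
  (∀ n, 1 ≤ n → 1 ≤ k n) ∧ ∀ m n, 1 ≤ m → m ≤ n → k m ≤ k n

end LocWord

/-!
Both halves of the theorem are instances of one statement about lists `(n₁, c₁), …, (n_l, c_l)`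
with `n₁ < … < n_l`, where `c_i` is a letter from a finite set `D n_i` or the variable. Such a list
encodes the word `w_{n₁}(c₁) ⋆ … ⋆ w_{n_l}(c_l)` extracted from the given sequence
(`LocWord.prodBy`), concatenation of lists becomes `⋆`, and extraction from a sequence of lists
becomes extraction from the corresponding sequence of words (`LocWord.prodBy_extractList`). The
substituted letters stay dominated by `k`, because the places in `w_n` have absolute value at least
`n` and `k` increases (`LocWord.index_le_abs`).

For lists the argument is the ultrafilter proof of Carlson's theorem. The ultrafilters that contain
all sets of words with indices at least `N` form a compact semigroup, in which those on constant
words form a compact subsemigroup and those on words with variable a two-sided ideal. Substitution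
of a letter is a homomorphism into the constant part and is the identity there. If `p` is a minimal
idempotent of the constant part and `q ≤ p` is an idempotent of the ideal, then the image of `q`
under any substitution is an idempotent below `p`, hence equal to `p`
(`exists_idempotent_eq_map_substList`). As infinitely many letters are treated at once, alphabets
that grow with the index cause no trouble.

Let `x₀` be the limit of `T^w(x)` along `p`. The sets of words with `T^w(x)` within `1 / (n + 1)` of
`x₀` belong to `p`, and a Galvin-style recursion, whose steps choose words that are typical for `q`,
gives a sequence such that all constant words extracted from its `n`-th tail lie in the `n`-th of
these sets (`exists_sequence_extractList_mem`). This is the first limit. The second follows from it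
and continuity: `T^w(x₀)` is the limit of `T^w(T^v(x)) = T^{w ⋆ v}(x)` as `v` goes to infinity within
the extracted words (`exists_sequence_limit`).
-/

/-! ### Idempotents in compact semigroups with one-sidedly continuous multiplication -/

section CompactSemigroup

variable {S : Type*} [Semigroup S] [TopologicalSpace S] [T2Space S]

/-- A compact subsemigroup contains an idempotent that is minimal for the order
`r ≤ p ↔ r * p = r ∧ p * r = r` on its idempotents. -/
theorem exists_minimal_idempotent (hcont : ∀ r : S, Continuous (· * r)) (s : Set S)
    (hne : s.Nonempty) (hs : IsCompact s) (hmul : ∀ x ∈ s, ∀ y ∈ s, x * y ∈ s) :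
    ∃ p ∈ s, p * p = p ∧ ∀ r ∈ s, r * r = r → r * p = r → p * r = r → r = p := by
  let I : Set (Set S) := {t | t ⊆ s ∧ t.Nonempty ∧ IsClosed t ∧ ∀ x ∈ s, ∀ y ∈ t, x * y ∈ t}
  obtain ⟨t, ht⟩ : ∃ t, Minimal (· ∈ I) t := by
    refine zorn_superset I fun c hcI hc => ?_
    rcases c.eq_empty_or_nonempty with rfl | hcne
    · exact ⟨s, ⟨subset_rfl, hne, hs.isClosed, hmul⟩, by simp⟩
    · refine ⟨⋂₀ c, ⟨?_, ?_, ?_, ?_⟩, fun t ht => Set.sInter_subset_of_mem ht⟩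
      · obtain ⟨t, ht⟩ := hcne
        exact (Set.sInter_subset_of_mem ht).trans (hcI ht).1
      · have : Nonempty c := hcne.to_subtype
        exact IsCompact.nonempty_sInter_of_directed_nonempty_isCompact_isClosed
          (fun a ha b hb => (hc.total ha hb).elim (fun h => ⟨a, ha, subset_rfl, h⟩)
            fun h => ⟨b, hb, h, subset_rfl⟩)
          (fun t ht => (hcI ht).2.1)
          (fun t ht => hs.of_isClosed_subset (hcI ht).2.2.1 (hcI ht).1)
          (fun t ht => (hcI ht).2.2.1)
      · exact isClosed_sInter fun t ht => (hcI ht).2.2.1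
      · exact fun x hx y hy t ht => (hcI ht).2.2.2 x hx y (hy t ht)
  obtain ⟨hts, htne, htc, htl⟩ := ht.prop
  obtain ⟨p, hpt, hpp⟩ := exists_idempotent_in_compact_subsemigroup hcont t htne
    (hs.of_isClosed_subset htc hts) fun x hx y hy => htl x (hts hx) y hy
  refine ⟨p, hts hpt, hpp, fun r hr hrr hrp hpr => ?_⟩
  have hrt : r ∈ t := hrp ▸ htl r hr p hpt
  -- `s * r` is a closed left ideal inside the minimal one, so it contains `p`.
  have hsr : (· * r) '' s ∈ I := by
    refine ⟨?_, hne.image _, (hs.image (hcont r)).isClosed, ?_⟩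
    · rintro _ ⟨x, hx, rfl⟩
      exact hmul x hx r hr
    · rintro x hx _ ⟨y, hy, rfl⟩
      exact ⟨x * y, hmul x hx y hy, mul_assoc _ _ _⟩
  have hsub : (· * r) '' s ⊆ t := by
    rintro _ ⟨x, hx, rfl⟩
    exact htl x hx r hrt
  obtain ⟨x, -, hx⟩ := ht.le_of_le hsr hsub hpt
  rw [← hpr, ← hx]
  simp only [mul_assoc, hrr]

/-- Let the compact semigroup `c` act from both sides on the compact semigroup `v`, and let the
homomorphisms `φ i` retract `c ∪ v` onto `c`. Then some idempotent of `c` is the common image of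
one element of `v` under all `φ i`. -/
theorem exists_idempotent_eq_map (hcont : ∀ r : S, Continuous (· * r)) {c v : Set S}
    (hc : IsCompact c) (hv : IsCompact v) (hcne : c.Nonempty) (hvne : v.Nonempty)
    (hcc : ∀ x ∈ c, ∀ y ∈ c, x * y ∈ c) (hvv : ∀ x ∈ v, ∀ y ∈ v, x * y ∈ v)
    (hcv : ∀ x ∈ c, ∀ y ∈ v, x * y ∈ v) (hvc : ∀ x ∈ v, ∀ y ∈ c, x * y ∈ v)
    {ι : Type*} (φ : ι → S → S) (hφ : ∀ i x y, φ i (x * y) = φ i x * φ i y)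
    (hφc : ∀ i, ∀ x ∈ c, φ i x = x) (hφv : ∀ i, ∀ x ∈ v, φ i x ∈ c) :
    ∃ p ∈ c, p * p = p ∧ ∃ q ∈ v, ∀ i, φ i q = p := by
  obtain ⟨p, hp, hpp, hmin⟩ := exists_minimal_idempotent hcont c hcne hc hcc
  obtain ⟨_, ⟨x, hx, rfl⟩, hq⟩ := exists_idempotent_in_compact_subsemigroup hcont ((· * p) '' v)
    (hvne.image _) (hv.image (hcont p)) (by
      rintro _ ⟨x, hx, rfl⟩ _ ⟨y, hy, rfl⟩
      exact ⟨x * p * y, hvv _ (hvc x hx p hp) y hy, mul_assoc _ _ _⟩)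
  -- `p * x * p` is an idempotent of `v` below `p`, so its images are idempotents of `c` below `p`.
  replace hq : x * p * (x * p) = x * p := hq
  have hqv : p * (x * p) ∈ v := hcv p hp _ (hvc x hx p hp)
  have hqq : p * (x * p) * (p * (x * p)) = p * (x * p) := by
    calc p * (x * p) * (p * (x * p)) = p * (x * (p * p) * (x * p)) := by simp only [mul_assoc]
      _ = p * (x * p) := by rw [hpp, hq]
  have hqp : p * (x * p) * p = p * (x * p) := by simp only [mul_assoc, hpp]
  have hpq : p * (p * (x * p)) = p * (x * p) := by rw [← mul_assoc, hpp]
  refine ⟨p, hp, hpp, p * (x * p), hqv, fun i => hmin _ (hφv i _ hqv) ?_ ?_ ?_⟩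
  · rw [← hφ, hqq]
  · rw [← hφc i p hp, ← hφ, hφc i p hp, hqp]
  · nth_rewrite 1 [← hφc i p hp]
    rw [← hφ, hpq]

end CompactSemigroup

/-! ### Located words as lists -/

section ListWord

variable {B : Type*}

/-- The lists `(n₁, c₁), …, (n_l, c_l)` with `l ≥ 1`, `N ≤ n₁ < … < n_l`, and each `c_i` either
the variable `none` or a letter from `D n_i`. -/
def listWords (D : ℕ → Set B) (N : ℕ) : Set (List (ℕ × Option B)) :=
  {l | l ≠ [] ∧ l.Pairwise (fun e e' => e.1 < e'.1) ∧
    ∀ e ∈ l, N ≤ e.1 ∧ ∀ b, e.2 = some b → b ∈ D e.1}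

/-- The lists in which the variable does not occur. -/
def constLists (B : Type*) : Set (List (ℕ × Option B)) := {l | ∀ e ∈ l, e.2 ≠ none}

/-- Substitution of `c` for the variable in a list; `c = none` changes nothing. -/
def substList (c : Option B) (l : List (ℕ × Option B)) : List (ℕ × Option B) :=
  l.map fun e => (e.1, e.2.or c)

/-- `s_{n₁}(c₁) ++ … ++ s_{n_l}(c_l)` for the list of the pairs `(n_i, c_i)`. -/
def extractList (s : ℕ → List (ℕ × Option B)) (l : List (ℕ × Option B)) : List (ℕ × Option B) :=
  l.flatMap fun e => substList e.2 (s e.1)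

theorem listWords_anti (D : ℕ → Set B) {M N : ℕ} (h : M ≤ N) : listWords D N ⊆ listWords D M :=
  fun _ hl => ⟨hl.1, hl.2.1, fun e he => ⟨h.trans (hl.2.2 e he).1, (hl.2.2 e he).2⟩⟩

theorem append_mem_listWords {D : ℕ → Set B} {N : ℕ} {l l' : List (ℕ × Option B)}
    (hl : l ∈ listWords D N) (hl' : l' ∈ listWords D N)
    (h : ∀ e ∈ l, ∀ e' ∈ l', e.1 < e'.1) : l ++ l' ∈ listWords D N := by
  refine ⟨by simp [hl.1], List.pairwise_append.2 ⟨hl.2.1, hl'.2.1, h⟩, fun e he => ?_⟩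
  rcases List.mem_append.1 he with he | he
  exacts [hl.2.2 e he, hl'.2.2 e he]

theorem substList_append (c : Option B) (l l' : List (ℕ × Option B)) :
    substList c (l ++ l') = substList c l ++ substList c l' := List.map_append

theorem substList_of_const (c : Option B) {l : List (ℕ × Option B)} (hl : l ∈ constLists B) :
    substList c l = l := by
  refine (List.map_congr_left fun e he => ?_).trans (List.map_id l)
  obtain ⟨n, _ | b⟩ := e
  · exact absurd rfl (hl _ he)
  · rfl

theorem substList_some_const (b : B) (l : List (ℕ × Option B)) :
    substList (some b) l ∈ constLists B := by
  intro e he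
  obtain ⟨e, -, rfl⟩ := List.mem_map.1 he
  cases e.2 <;> simp

theorem substList_mem_listWords {D : ℕ → Set B} (hD : Monotone D) {N n : ℕ} {b : B}
    (hb : b ∈ D n) {l : List (ℕ × Option B)} (hl : l ∈ listWords D N) (hn : ∀ e ∈ l, n ≤ e.1) :
    substList (some b) l ∈ listWords D N := by
  refine ⟨by simpa [substList] using hl.1, List.pairwise_map.2 hl.2.1, fun e he => ?_⟩
  obtain ⟨e, hel, rfl⟩ := List.mem_map.1 he
  refine ⟨(hl.2.2 e hel).1, fun b' hb' => ?_⟩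
  cases h : e.2 with
  | none =>
    obtain rfl : b = b' := by simpa [h] using hb'
    exact hD (hn e hel) hb
  | some a =>
    obtain rfl : a = b' := by simpa [h] using hb'
    exact (hl.2.2 e hel).2 a h

theorem extractList_const (s : ℕ → List (ℕ × Option B)) {l : List (ℕ × Option B)}
    (hl : l ∈ constLists B) : extractList s l ∈ constLists B := by
  intro e he
  obtain ⟨a, ha, he⟩ := List.mem_flatMap.1 he
  obtain ⟨b, hb⟩ := Option.ne_none_iff_exists'.1 (hl a ha)
  rw [hb] at he
  exact substList_some_const b _ e he

/-- If the lists `s 0 < s 1 < …` are separated and the indices in `s n` are at least `n`, then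
extraction from `s` leads from words to words. -/
theorem extractList_mem_listWords {D : ℕ → Set B} (hD : Monotone D) {N : ℕ}
    {s : ℕ → List (ℕ × Option B)} (hs : ∀ n, s n ∈ listWords D N)
    (hlt : ∀ m n, m < n → ∀ e ∈ s m, ∀ e' ∈ s n, e.1 < e'.1) (hge : ∀ n, ∀ e ∈ s n, n ≤ e.1)
    {l : List (ℕ × Option B)} {M : ℕ} (hl : l ∈ listWords D M) :
    extractList s l ∈ listWords D N := by
  have hone : ∀ e ∈ l, substList e.2 (s e.1) ∈ listWords D N := by
    rintro ⟨n, _ | b⟩ he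
    · simpa [substList] using hs n
    · exact substList_mem_listWords hD ((hl.2.2 _ he).2 b rfl) (hs n) (hge n)
  refine ⟨?_, ?_, fun a ha => ?_⟩
  · obtain ⟨e, he⟩ := List.exists_mem_of_ne_nil l hl.1
    obtain ⟨a, ha⟩ := List.exists_mem_of_ne_nil _ (hone e he).1
    exact List.ne_nil_of_mem (List.mem_flatMap.2 ⟨e, he, ha⟩)
  · refine List.pairwise_flatMap.2 ⟨fun e he => (hone e he).2.1, hl.2.1.imp ?_⟩
    intro e e' hee a ha a' ha'
    obtain ⟨a, has, rfl⟩ := List.mem_map.1 ha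
    obtain ⟨a', has', rfl⟩ := List.mem_map.1 ha'
    exact hlt _ _ hee a has a' has'
  · obtain ⟨e, he, ha⟩ := List.mem_flatMap.1 ha
    exact (hone e he).2.2 a ha

end ListWord

/-! ### Ultrafilters on lists -/

section Ultrafilter

open Filter

variable {B : Type*}

/-- Lists form a semigroup under concatenation. -/
@[reducible] def List.appendSemigroup (C : Type*) : Semigroup (List C) where
  mul l l' := l ++ l'
  mul_assoc := List.append_assoc

attribute [local instance] List.appendSemigroup Ultrafilter.mul Ultrafilter.semigroup

/-- The ultrafilters on lists that contain, for every `N`, the set of all words over `D` with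
indices at least `N`. -/
def farUltrafilters (D : ℕ → Set B) : Set (Ultrafilter (List (ℕ × Option B))) :=
  {U | ∀ N, listWords D N ∈ U}

theorem isClosed_farUltrafilters (D : ℕ → Set B) : IsClosed (farUltrafilters D) := by
  have : farUltrafilters D = ⋂ N, {U | listWords D N ∈ U} := by
    ext U
    simp [farUltrafilters]
  rw [this]
  exact isClosed_iInter fun N => ultrafilter_isClosed_basic _

theorem exists_index_bound (l : List (ℕ × Option B)) (K : ℕ) :
    ∃ K', K ≤ K' ∧ ∀ e ∈ l, e.1 < K' := by
  refine ⟨K + (l.map Prod.fst).sum + 1, by omega, fun e he => ?_⟩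
  have : e.1 ≤ (l.map Prod.fst).sum := List.le_sum_of_mem (List.mem_map_of_mem he)
  omega

theorem eventually_forall_lt {D : ℕ → Set B} {U : Ultrafilter (List (ℕ × Option B))}
    (hU : U ∈ farUltrafilters D) (l : List (ℕ × Option B)) :
    ∀ᶠ l' in (U : Filter (List (ℕ × Option B))), ∀ e ∈ l, ∀ e' ∈ l', e.1 < e'.1 := by
  obtain ⟨K, -, hK⟩ := exists_index_bound l 0
  filter_upwards [hU K] with l' hl' e he e' he'
  exact (hK e he).trans_le (hl'.2.2 e' he').1

theorem mul_mem_farUltrafilters {D : ℕ → Set B} {U V : Ultrafilter (List (ℕ × Option B))}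
    (hU : U ∈ farUltrafilters D) (hV : V ∈ farUltrafilters D) : U * V ∈ farUltrafilters D := by
  intro N
  refine (Ultrafilter.eventually_mul U V (· ∈ listWords D N)).2 ?_
  filter_upwards [hU N] with l hl
  filter_upwards [hV N, eventually_forall_lt hV l] with l' hl' hlt
  exact append_mem_listWords hl hl' hlt

theorem map_mul_of_map_mul {M : Type*} [Semigroup M] {f : M → M}
    (hf : ∀ x y, f (x * y) = f x * f y) (U V : Ultrafilter M) :
    (U * V).map f = U.map f * V.map f := by
  refine Ultrafilter.coe_injective (Filter.ext fun s => ?_)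
  have h1 := Ultrafilter.eventually_mul U V (fun x => f x ∈ s)
  have h2 := Ultrafilter.eventually_mul (U.map f) (V.map f) (· ∈ s)
  refine (h1.trans ?_).trans h2.symm
  simp only [hf]
  rfl

/-- There is an idempotent ultrafilter which is the image of one ultrafilter of far variable words
under all substitutions of letters. -/
theorem exists_idempotent_eq_map_substList {D : ℕ → Set B} (hD : Monotone D)
    (hne : (D 0).Nonempty) :
    ∃ p : Ultrafilter (List (ℕ × Option B)), p * p = p ∧
      ∃ q ∈ farUltrafilters D, (constLists B)ᶜ ∈ q ∧
        ∀ n, ∀ b ∈ D n, q.map (substList (some b)) = p := by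
  let c := {U ∈ farUltrafilters D | constLists B ∈ U}
  let v := {U ∈ farUltrafilters D | (constLists B)ᶜ ∈ U}
  have hmap : ∀ n, ∀ b ∈ D n, ∀ U ∈ farUltrafilters D, U.map (substList (some b)) ∈ c := by
    intro n b hb U hU
    refine ⟨fun N => ?_, Ultrafilter.mem_map.2 (univ_mem' fun l => substList_some_const b l)⟩
    refine Ultrafilter.mem_map.2 (mem_of_superset (hU (max N n)) fun l hl => ?_)
    exact substList_mem_listWords hD hb (listWords_anti D (le_max_left N n) hl)
      fun e he => (le_max_right N n).trans (hl.2.2 e he).1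
  have hvne : v.Nonempty := by
    let s : ℕ → List (ℕ × Option B) := fun n => [(n, none)]
    refine ⟨(Ultrafilter.of atTop).map s, fun N => ?_, ?_⟩
    · refine Ultrafilter.mem_map.2 (Ultrafilter.of_le atTop ?_)
      filter_upwards [eventually_ge_atTop N] with n hn
      simp [s, listWords, hn]
    · exact Ultrafilter.mem_map.2 (univ_mem' fun n => by simp [s, constLists])
  obtain ⟨b₀, hb₀⟩ := hne
  have hcne : c.Nonempty := by
    obtain ⟨U, hU⟩ := hvne
    exact ⟨_, hmap 0 b₀ hb₀ U hU.1⟩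
  have hmul : ∀ (U V : Ultrafilter (List (ℕ × Option B))) (s t r : Set (List (ℕ × Option B))),
      s ∈ U → t ∈ V → (∀ x ∈ s, ∀ y ∈ t, x ++ y ∈ r) → r ∈ U * V := by
    intro U V s t r hs ht h
    refine (Ultrafilter.eventually_mul U V (· ∈ r)).2 ?_
    filter_upwards [hs] with x hx
    filter_upwards [ht] with y hy
    exact h x hx y hy
  have hconst : ∀ x y : List (ℕ × Option B),
      x ++ y ∈ constLists B ↔ x ∈ constLists B ∧ y ∈ constLists B := by
    intro x y
    simp only [constLists, Set.mem_ofPred_eq, List.mem_append, or_imp, forall_and]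
  obtain ⟨p, -, hpp, q, hq, hpq⟩ := exists_idempotent_eq_map
    (Ultrafilter.continuous_mul_left (M := List (ℕ × Option B))) (c := c) (v := v)
    ((isClosed_farUltrafilters D).inter (ultrafilter_isClosed_basic _)).isCompact
    ((isClosed_farUltrafilters D).inter (ultrafilter_isClosed_basic _)).isCompact
    hcne hvne
    (fun U hU V hV => ⟨mul_mem_farUltrafilters hU.1 hV.1,
      hmul U V _ _ _ hU.2 hV.2 fun x hx y hy => (hconst x y).2 ⟨hx, hy⟩⟩)
    (fun U hU V hV => ⟨mul_mem_farUltrafilters hU.1 hV.1,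
      hmul U V _ _ _ hU.2 hV.2 fun x hx y _ h => hx ((hconst x y).1 h).1⟩)
    (fun U hU V hV => ⟨mul_mem_farUltrafilters hU.1 hV.1,
      hmul U V _ _ _ hU.2 hV.2 fun x _ y hy h => hy ((hconst x y).1 h).2⟩)
    (fun U hU V hV => ⟨mul_mem_farUltrafilters hU.1 hV.1,
      hmul U V _ _ _ hU.2 hV.2 fun x hx y _ h => hx ((hconst x y).1 h).1⟩)
    (fun (b : {b : B // ∃ n, b ∈ D n}) U => U.map (substList (some b.1)))
    (fun b => map_mul_of_map_mul (substList_append (some b.1)))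
    (fun b U hU => by
      refine (Ultrafilter.coe_injective ?_)
      refine (Filter.map_congr (m₂ := id) ?_).trans Filter.map_id
      filter_upwards [hU.2] with l hl
      exact substList_of_const _ hl)
    (fun b U hU => b.2.elim fun n hn => hmap n b.1 hn U hU.1)
  exact ⟨p, hpp, q, hq.1, hq.2, fun n b hb => hpq ⟨b, n, hb⟩⟩

/-- Given sets `A n` in the idempotent `p`, the words `s n` are chosen one after the other such that
every constant word extracted from `s n, s (n + 1), …` lies in `A n`. -/
theorem exists_sequence_extractList_mem {D : ℕ → Set B} (hfin : ∀ n, (D n).Finite)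
    {p q : Ultrafilter (List (ℕ × Option B))}
    (hpp : p * p = p) (hq : q ∈ farUltrafilters D) (hqv : (constLists B)ᶜ ∈ q)
    (hqp : ∀ n, ∀ b ∈ D n, q.map (substList (some b)) = p)
    (A : ℕ → Set (List (ℕ × Option B))) (hA : ∀ n, A n ∈ p) (N : ℕ) :
    ∃ s : ℕ → List (ℕ × Option B), (∀ n, s n ∈ listWords D N) ∧ (∀ n, s n ∉ constLists B) ∧
      (∀ m n, m < n → ∀ e ∈ s m, ∀ e' ∈ s n, e.1 < e'.1) ∧
      ∀ n, ∀ l ∈ listWords D n, l ∈ constLists B → extractList s l ∈ A n := by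
  -- A state is a set `E` in `p`, to which all further extracted words are to belong, together with
  -- a lower bound `K` for all further indices.
  let St := {P : Set (List (ℕ × Option B)) × ℕ // P.1 ∈ p}
  have step : ∀ (n : ℕ) (P : St), ∃ Q : List (ℕ × Option B) × St,
      Q.1 ∈ listWords D P.1.2 ∧ Q.1 ∉ constLists B ∧
      (∀ b ∈ D n, substList (some b) Q.1 ∈ P.1.1) ∧
      Q.2.1.1 ⊆ P.1.1 ∧ Q.2.1.1 ⊆ A (n + 1) ∧
      (∀ b ∈ D n, ∀ y ∈ Q.2.1.1, substList (some b) Q.1 ++ y ∈ P.1.1) ∧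
      P.1.2 ≤ Q.2.1.2 ∧ ∀ e ∈ Q.1, e.1 < Q.2.1.2 := by
    rintro n ⟨⟨E, K⟩, hE⟩
    have hE' : ∀ᶠ l in (p : Filter _), ∀ᶠ y in (p : Filter _), l ++ y ∈ E :=
      (Ultrafilter.eventually_mul p p (· ∈ E)).1 (by rw [hpp]; exact hE)
    have hall : ∀ᶠ l in (q : Filter _), ∀ b ∈ D n, substList (some b) l ∈ E ∧
        ∀ᶠ y in (p : Filter _), substList (some b) l ++ y ∈ E := by
      refine (eventually_all_finite (hfin n)).2 fun b hb => ?_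
      have h : {l | l ∈ E ∧ ∀ᶠ y in (p : Filter _), l ++ y ∈ E} ∈ q.map (substList (some b)) :=
        (hqp n b hb).symm ▸ Filter.Eventually.and hE hE'
      exact Ultrafilter.mem_map.1 h
    obtain ⟨l, ⟨hl, hlK⟩, hlv⟩ := ((hall.and (hq K)).and hqv).exists
    obtain ⟨K', hK', hlK'⟩ := exists_index_bound l K
    refine ⟨⟨l, ⟨⟨E ∩ A (n + 1) ∩ {y | ∀ b ∈ D n, substList (some b) l ++ y ∈ E}, K'⟩, ?_⟩⟩,
      hlK, hlv, fun b hb => (hl b hb).1, fun y hy => hy.1.1, fun y hy => hy.1.2,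
      fun b hb y hy => hy.2 b hb, hK', hlK'⟩
    exact inter_mem (inter_mem hE (hA _))
      ((eventually_all_finite (hfin n)).2 fun b hb => (hl b hb).2)
  choose next hw hv hb hE hEA hEb hK hlt using step
  let st : ℕ → St := fun n => Nat.rec ⟨(A 0, N), hA 0⟩ (fun n P => (next n P).2) n
  let s : ℕ → List (ℕ × Option B) := fun n => (next n (st n)).1
  have hKmono : Monotone fun n => (st n).1.2 := monotone_nat_of_le_succ fun n => hK n (st n)
  have hEanti : Antitone fun n => (st n).1.1 := antitone_nat_of_succ_le fun n => hE n (st n)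
  have hstA : ∀ n, (st n).1.1 ⊆ A n := by
    rintro (_ | n)
    · exact subset_rfl
    · exact hEA n (st n)
  refine ⟨s, fun n => listWords_anti D (hKmono n.zero_le) (hw n (st n)), fun n => hv n (st n),
    fun m n hmn e he e' he' => ?_, fun n l hl hlc => hstA n ?_⟩
  · exact ((hlt m (st m) e he).trans_le (hKmono (Nat.succ_le_of_lt hmn))).trans_le
      ((hw n (st n)).2.2 e' he').1
  · induction l generalizing n with
    | nil => exact absurd rfl hl.1
    | cons e t ih =>
      obtain ⟨m, c⟩ := e
      obtain ⟨b, rfl⟩ := Option.ne_none_iff_exists'.1 (hlc (m, c) List.mem_cons_self)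
      obtain ⟨hnm, hbm⟩ := hl.2.2 (m, some b) List.mem_cons_self
      refine hEanti hnm ?_
      have hcons : extractList s ((m, some b) :: t) =
          substList (some b) (s m) ++ extractList s t := List.flatMap_cons
      rw [hcons]
      rcases eq_or_ne t [] with rfl | ht
      · simpa [extractList] using hb m (st m) b (hbm b rfl)
      · refine hEb m (st m) b (hbm b rfl) _ (ih (m + 1) ⟨ht, (List.pairwise_cons.1 hl.2.1).2, ?_⟩
          fun e he => hlc e (List.mem_cons_of_mem _ he))
        exact fun e he => ⟨(List.pairwise_cons.1 hl.2.1).1 e he,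
          (hl.2.2 e (List.mem_cons_of_mem _ he)).2⟩

theorem le_index_of_separated {D : ℕ → Set B} {N : ℕ} {s : ℕ → List (ℕ × Option B)}
    (hs : ∀ n, s n ∈ listWords D N)
    (hlt : ∀ m n, m < n → ∀ e ∈ s m, ∀ e' ∈ s n, e.1 < e'.1) (n : ℕ) : ∀ e ∈ s n, n ≤ e.1 := by
  induction n with
  | zero => exact fun _ _ => Nat.zero_le _
  | succ n ih =>
    intro e he
    obtain ⟨a, ha⟩ := List.exists_mem_of_ne_nil _ (hs n).1
    exact (ih a ha).trans_lt (hlt n (n + 1) n.lt_succ_self a ha e he)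

/-- The limit theorem for words as lists: an action `F` of the constant words on a compact space
has, along all words extracted from a suitable sequence, one limit point for the orbit of `x`,
and this point is also the limit of its own orbit. -/
theorem exists_sequence_limit {D : ℕ → Set B} (hD : Monotone D) (hne : (D 0).Nonempty)
    (hfin : ∀ n, (D n).Finite) {X : Type*} [MetricSpace X] [CompactSpace X] (N : ℕ)
    (F : List (ℕ × Option B) → X → X)
    (hF : ∀ l ∈ listWords D N, l ∈ constLists B → Continuous (F l))
    (hmul : ∀ l ∈ listWords D N, l ∈ constLists B → ∀ l' ∈ listWords D N, l' ∈ constLists B →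
      (∀ e ∈ l, ∀ e' ∈ l', e.1 < e'.1) → F l ∘ F l' = F (l ++ l')) (x : X) :
    ∃ (s : ℕ → List (ℕ × Option B)) (x₀ : X), (∀ n, s n ∈ listWords D N) ∧
      (∀ n, s n ∉ constLists B) ∧ (∀ m n, m < n → ∀ e ∈ s m, ∀ e' ∈ s n, e.1 < e'.1) ∧
      ∀ V ∈ 𝓝 x₀, ∃ n, ∀ l ∈ listWords D n, l ∈ constLists B →
        F (extractList s l) x ∈ V ∧ F (extractList s l) x₀ ∈ V := by
  obtain ⟨p, hpp, q, hq, hqv, hqp⟩ := exists_idempotent_eq_map_substList hD hne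
  let x₀ := (p.map fun l => F l x).lim
  have hlim : Tendsto (fun l => F l x) p (𝓝 x₀) := (p.map fun l => F l x).le_nhds_lim
  obtain ⟨s, hs, hsv, hlt, hsA⟩ := exists_sequence_extractList_mem hfin hpp hq hqv hqp
    (fun n => {l | F l x ∈ Metric.ball x₀ (1 / ((n : ℝ) + 1))})
    (fun n => hlim (Metric.ball_mem_nhds x₀ Nat.one_div_pos_of_nat)) N
  have hge := le_index_of_separated hs hlt
  refine ⟨s, x₀, hs, hsv, hlt, fun V hV => ?_⟩
  obtain ⟨ε, hε, hεV⟩ := Metric.nhds_basis_closedBall.mem_iff.1 hV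
  have hclose : ∀ δ > 0, ∃ n, ∀ l ∈ listWords D n, l ∈ constLists B →
      F (extractList s l) x ∈ Metric.closedBall x₀ δ := by
    intro δ hδ
    obtain ⟨n, hn⟩ := exists_nat_one_div_lt hδ
    exact ⟨n, fun l hl hlc => Metric.ball_subset_closedBall
      (Metric.ball_subset_ball hn.le (hsA n l hl hlc))⟩
  obtain ⟨n, hn⟩ := hclose ε hε
  refine ⟨n, fun l hl hlc => ⟨hεV (hn l hl hlc), hεV ?_⟩⟩
  -- `F l x₀` is the limit of `F l (F [s m (b)] x) = F (l ++ [s m (b)]) x` as `m → ∞`.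
  obtain ⟨b, hb⟩ := hne
  have hlw := extractList_mem_listWords hD hs hlt hge hl
  have hlcc := extractList_const s hlc
  have hmw : ∀ m, [(m, some b)] ∈ listWords D m := fun m => by
    simpa [listWords] using hD m.zero_le hb
  have hmc : ∀ m : ℕ, [(m, some b)] ∈ constLists B := fun m => by simp [constLists]
  have htend : Tendsto (fun m => F (extractList s [(m, some b)]) x) atTop (𝓝 x₀) := by
    refine Metric.nhds_basis_closedBall.tendsto_right_iff.2 fun δ hδ => ?_
    obtain ⟨m₀, hm₀⟩ := hclose δ hδ
    filter_upwards [eventually_ge_atTop m₀] with m hm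
    exact hm₀ _ (listWords_anti D hm (hmw m)) (hmc m)
  refine Metric.isClosed_closedBall.mem_of_tendsto (((hF _ hlw hlcc).tendsto x₀).comp htend) ?_
  obtain ⟨M, hnM, hM⟩ := exists_index_bound l n
  filter_upwards [eventually_ge_atTop M] with m hm
  have hsep : ∀ e ∈ l, ∀ e' ∈ [(m, some b)], e.1 < e'.1 := by
    intro e he e' he'
    rw [List.mem_singleton.1 he']
    exact (hM e he).trans_le hm
  have happ := append_mem_listWords hl (listWords_anti D (hnM.trans hm) (hmw m)) hsep
  have hw := extractList_mem_listWords hD hs hlt hge happ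
  have heq : extractList s (l ++ [(m, some b)]) =
      extractList s l ++ extractList s [(m, some b)] := List.flatMap_append
  have hcomp := hmul _ hlw hlcc _ (extractList_mem_listWords hD hs hlt hge (hmw m))
    (extractList_const s (hmc m)) (by
      rw [heq] at hw
      exact (List.pairwise_append.1 hw.2.1).2.2)
  have := hn _ happ (by
    intro e he
    rcases List.mem_append.1 he with he | he
    exacts [hlc e he, hmc m e he])
  rw [heq, ← hcomp] at this
  exact this

end Ultrafilter

/-! ### Products of located words -/

namespace LocWord

variable {A B : Type*}

/-- Substitution in a located word, where the choice `b` stands for the letters `g b n` at the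
places `n`, and `none` leaves the word unchanged. Both kinds of substitution, `subst₁` and
`subst₂`, are instances. -/
def substBy (g : B → ℤ → A) (c : Option B) (w : LocWord A) : LocWord A :=
  match c with
  | none => w
  | some b => w.fill (g b)

/-- `w_{n₁}(c₁) ⋆ … ⋆ w_{n_l}(c_l)` for the list of the pairs `(n_i, c_i)`. -/
def prodBy (g : B → ℤ → A) (w : ℕ → LocWord A) (l : List (ℕ × Option B)) : LocWord A :=
  (l.map fun e => substBy g e.2 (w e.1)).foldr conc empty

theorem empty_conc (w : LocWord A) : conc empty w = w := by
  ext1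
  funext n
  simp [conc, empty]

theorem conc_assoc (w u v : LocWord A) : conc (conc w u) v = conc w (conc u v) := by
  ext1
  funext n
  simp [conc, Option.or_assoc]

theorem prodBy_cons (g : B → ℤ → A) (w : ℕ → LocWord A) (e : ℕ × Option B)
    (l : List (ℕ × Option B)) :
    prodBy g w (e :: l) = conc (substBy g e.2 (w e.1)) (prodBy g w l) := rfl

theorem prodBy_append (g : B → ℤ → A) (w : ℕ → LocWord A) (l l' : List (ℕ × Option B)) :
    prodBy g w (l ++ l') = conc (prodBy g w l) (prodBy g w l') := by
  induction l with
  | nil => exact (empty_conc _).symm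
  | cons e l ih => rw [List.cons_append, prodBy_cons, prodBy_cons, ih, conc_assoc]

theorem substBy_conc (g : B → ℤ → A) (c : Option B) (w u : LocWord A) :
    substBy g c (conc w u) = conc (substBy g c w) (substBy g c u) := by
  cases c with
  | none => rfl
  | some b =>
    ext1
    funext n
    simp [substBy, fill, conc, Option.map_or]

theorem substBy_substBy (g : B → ℤ → A) (c d : Option B) (w : LocWord A) :
    substBy g c (substBy g d w) = substBy g (d.or c) w := by
  rcases d with _ | d
  · rfl
  rcases c with _ | c
  · rfl
  ext1
  funext n
  rcases h : w.toFun n with _ | _ | _ <;> simp [substBy, fill, fillSym, h]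

theorem prodBy_substList (g : B → ℤ → A) (w : ℕ → LocWord A) (c : Option B)
    (l : List (ℕ × Option B)) : prodBy g w (substList c l) = substBy g c (prodBy g w l) := by
  induction l with
  | nil =>
    cases c
    · rfl
    · ext1
      funext n
      simp [substList, prodBy, empty, substBy, fill]
  | cons e l ih =>
    rw [prodBy_cons, substBy_conc, substBy_substBy, ← ih]
    rfl

/-- Extraction of words corresponds to extraction of lists. -/
theorem prodBy_extractList (g : B → ℤ → A) (w : ℕ → LocWord A) (s : ℕ → List (ℕ × Option B))
    (l : List (ℕ × Option B)) :
    prodBy g w (extractList s l) = prodBy g (fun n => prodBy g w (s n)) l := by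
  induction l with
  | nil => rfl
  | cons e l ih =>
    have : extractList s (e :: l) = substList e.2 (s e.1) ++ extractList s l := List.flatMap_cons
    rw [this, prodBy_append, prodBy_substList, ih, prodBy_cons]

theorem dom_substBy (g : B → ℤ → A) (c : Option B) (w : LocWord A) :
    (substBy g c w).dom = w.dom := by
  cases c
  · rfl
  · ext n
    simp [substBy, fill, dom]

theorem dom_conc (w u : LocWord A) : (conc w u).dom = w.dom ∪ u.dom := by
  ext n
  simp only [dom, conc, ne_eq, Option.or_eq_none_iff, Set.mem_union, Set.mem_ofPred_eq]
  tauto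

theorem mem_dom_prodBy {g : B → ℤ → A} {w : ℕ → LocWord A} {l : List (ℕ × Option B)} {n : ℤ} :
    n ∈ (prodBy g w l).dom ↔ ∃ e ∈ l, n ∈ (w e.1).dom := by
  induction l with
  | nil => simp [prodBy, dom, empty]
  | cons e l ih => simp [prodBy_cons, dom_conc, dom_substBy, ih]

theorem exists_of_prodBy_eq_some {g : B → ℤ → A} {w : ℕ → LocWord A} {l : List (ℕ × Option B)}
    {n : ℤ} {a : LSym A} (h : (prodBy g w l).toFun n = some a) :
    ∃ e ∈ l, (substBy g e.2 (w e.1)).toFun n = some a := by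
  induction l with
  | nil => exact absurd h (by simp [prodBy, empty])
  | cons e l ih =>
    rw [prodBy_cons] at h
    rcases Option.or_eq_some_iff.1 h with h | ⟨-, h⟩
    · exact ⟨e, List.mem_cons_self, h⟩
    · obtain ⟨e', he', h'⟩ := ih h
      exact ⟨e', List.mem_cons_of_mem _ he', h'⟩

/-! ### Sequences of located words that expand away from `0` -/

/-- The domain of each word of the sequence `w 1, w 2, …` avoids `0` and lies beyond the previous
ones: to the right at positive and to the left at negative places. -/
def Expanding (w : ℕ → LocWord A) : Prop :=
  (∀ n, 1 ≤ n → (0 : ℤ) ∉ (w n).dom) ∧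
    ∀ m n, 1 ≤ m → m < n → ∀ i ∈ (w m).dom, ∀ j ∈ (w n).dom, (0 < j → i < j) ∧ (j < 0 → j < i)

/-- A separation of consecutive words extends to all pairs if the intermediate words have
places on the same side. -/
theorem Expanding.of_succ {w : ℕ → LocWord A} (h0 : ∀ n, 1 ≤ n → (0 : ℤ) ∉ (w n).dom)
    (hpos : ∀ n, 1 ≤ n → ∃ i ∈ (w n).dom, 0 < i)
    (hneg : ∀ n, 1 ≤ n → ∀ j ∈ (w (n + 1)).dom, j < 0 → ∃ i ∈ (w n).dom, i < 0)
    (hsucc : ∀ n, 1 ≤ n → ∀ i ∈ (w n).dom, ∀ j ∈ (w (n + 1)).dom,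
      (0 < j → i < j) ∧ (j < 0 → j < i)) : Expanding w := by
  refine ⟨h0, fun m n hm hmn => ?_⟩
  induction n, hmn using Nat.le_induction with
  | base => exact hsucc m hm
  | succ n hmn ih =>
    have hn : 1 ≤ n := hm.trans (Nat.le_of_succ_le hmn)
    refine fun i hi j hj => ⟨fun h => ?_, fun h => ?_⟩
    · obtain ⟨a, ha, ha0⟩ := hpos n hn
      exact ((ih i hi a ha).1 ha0).trans ((hsucc n hn a ha j hj).1 h)
    · obtain ⟨a, ha, ha0⟩ := hneg n hn j hj h
      exact ((hsucc n hn a ha j hj).2 h).trans ((ih i hi a ha).2 ha0)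

theorem index_le_abs {w : ℕ → LocWord A} (hw : Expanding w)
    (hpos : ∀ n, 1 ≤ n → ∃ i ∈ (w n).dom, 0 < i)
    (hneg : ∀ n, 1 ≤ n → ∀ j ∈ (w (n + 1)).dom, j < 0 → ∃ i ∈ (w n).dom, i < 0)
    {n : ℕ} (hn : 1 ≤ n) : ∀ j ∈ (w n).dom, (0 < j → (n : ℤ) ≤ j) ∧ (j < 0 → j ≤ -(n : ℤ)) := by
  induction n, hn using Nat.le_induction with
  | base => intro j _; push_cast; omega
  | succ n hn ih =>
    intro j hj
    refine ⟨fun h => ?_, fun h => ?_⟩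
    · obtain ⟨i, hi, hi0⟩ := hpos n hn
      have h1 := (hw.2 n (n + 1) hn n.lt_succ_self i hi j hj).1 h
      have h2 := (ih i hi).1 hi0
      push_cast
      omega
    · obtain ⟨i, hi, hi0⟩ := hneg n hn j hj h
      have h1 := (hw.2 n (n + 1) hn n.lt_succ_self i hi j hj).2 h
      have h2 := (ih i hi).2 hi0
      push_cast
      omega

theorem Expanding.prodBy_lt {w : ℕ → LocWord A} (hw : Expanding w) {g : B → ℤ → A}
    {D : ℕ → Set B} {l l' : List (ℕ × Option B)} (hl : l ∈ listWords D 1)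
    (hlt : ∀ e ∈ l, ∀ e' ∈ l', e.1 < e'.1) {i j : ℤ}
    (hi : i ∈ (prodBy g w l).dom) (hj : j ∈ (prodBy g w l').dom) :
    (0 < j → i < j) ∧ (j < 0 → j < i) := by
  obtain ⟨e, he, hi⟩ := mem_dom_prodBy.1 hi
  obtain ⟨e', he', hj⟩ := mem_dom_prodBy.1 hj
  exact hw.2 _ _ (hl.2.2 e he).1 (hlt e he e' he') i hi j hj

theorem Expanding.index_unique {w : ℕ → LocWord A} (hw : Expanding w) {m n : ℕ} (hm : 1 ≤ m)
    (hn : 1 ≤ n) {i : ℤ} (him : i ∈ (w m).dom) (hin : i ∈ (w n).dom) : m = n := by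
  have h0 : i ≠ 0 := fun h => hw.1 m hm (h ▸ him)
  rcases lt_trichotomy m n with h | h | h
  · have := hw.2 m n hm h i him i hin
    omega
  · exact h
  · have := hw.2 n m hn h i hin i him
    omega

theorem Expanding.prodBy_apply {w : ℕ → LocWord A} (hw : Expanding w) (g : B → ℤ → A)
    {D : ℕ → Set B} {l : List (ℕ × Option B)} (hl : l ∈ listWords D 1) {e : ℕ × Option B}
    (he : e ∈ l) {i : ℤ} (hi : i ∈ (w e.1).dom) :
    (prodBy g w l).toFun i = (substBy g e.2 (w e.1)).toFun i := by
  obtain ⟨a, ha⟩ := Option.ne_none_iff_exists'.1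
    (show i ∈ (prodBy g w l).dom from mem_dom_prodBy.2 ⟨e, he, hi⟩)
  obtain ⟨e', he', ha'⟩ := exists_of_prodBy_eq_some ha
  have hi' : i ∈ (w e'.1).dom := by
    rw [← dom_substBy g e'.2]
    exact fun h => by simp [h] at ha'
  have hidx := hw.index_unique (hl.2.2 e he).1 (hl.2.2 e' he').1 hi hi'
  have hnd : (l.map Prod.fst).Nodup := List.pairwise_map.2 (hl.2.1.imp fun h => h.ne)
  have : e = e' := List.inj_on_of_nodup_map hnd he he' hidx
  rw [this, ha, ha']

theorem prodBy_mem_LtAll {α : ℤ → A} {k : ℤ → ℕ} {w : ℕ → LocWord A}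
    (hw : ∀ n, 1 ≤ n → w n ∈ LtAll α k) {g : B → ℤ → A} {D : ℕ → Set B}
    (hg : ∀ n, 1 ≤ n → ∀ b ∈ D n, ∀ i ∈ (w n).dom, g b i ∈ lettersAt α k i)
    {l : List (ℕ × Option B)} (hl : l ∈ listWords D 1) : prodBy g w l ∈ LtAll α k := by
  refine ⟨?_, fun h => ?_, fun i a h => ?_⟩
  · obtain ⟨e, he⟩ := List.exists_mem_of_ne_nil l hl.1
    obtain ⟨i, hi⟩ := (hw e.1 (hl.2.2 e he).1).1
    exact ⟨i, mem_dom_prodBy.2 ⟨e, he, hi⟩⟩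
  · obtain ⟨e, he, h⟩ := mem_dom_prodBy.1 h
    exact (hw e.1 (hl.2.2 e he).1).2.1 h
  · obtain ⟨⟨n, c⟩, he, h⟩ := exists_of_prodBy_eq_some h
    obtain ⟨hn, hc⟩ := hl.2.2 _ he
    rcases c with _ | b
    · exact (hw n hn).2.2 i a h
    · obtain ⟨y, hy, hya⟩ := Option.map_eq_some_iff.1 h
      rcases y with a' | _
      · obtain rfl : a' = a := by simpa [fillSym] using hya
        exact (hw n hn).2.2 i a' hy
      · obtain rfl : g b i = a := by simpa [fillSym] using hya
        exact hg n hn b (hc b rfl) i (by simp [dom, hy])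

theorem prodBy_mem_Lt {α : ℤ → A} {k : ℤ → ℕ} {w : ℕ → LocWord A}
    (hw : ∀ n, 1 ≤ n → w n ∈ LtAll α k) {g : B → ℤ → A} {D : ℕ → Set B}
    (hg : ∀ n, 1 ≤ n → ∀ b ∈ D n, ∀ i ∈ (w n).dom, g b i ∈ lettersAt α k i)
    {l : List (ℕ × Option B)} (hl : l ∈ listWords D 1) (hlc : l ∈ constLists B) :
    prodBy g w l ∈ Lt α k := by
  refine ⟨prodBy_mem_LtAll hw hg hl, fun i h => ?_⟩
  obtain ⟨⟨n, c⟩, he, h⟩ := exists_of_prodBy_eq_some h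
  obtain ⟨b, rfl⟩ := Option.ne_none_iff_exists'.1 (hlc _ he)
  obtain ⟨y, -, hy⟩ := Option.map_eq_some_iff.1 h
  cases y <;> simp [fillSym] at hy

/-- Products far from `0` at positive places involve only late words of the sequence. -/
theorem exists_far_bound {u : ℕ → LocWord A} (hpos : ∀ n, ∃ i ∈ (u n).dom, 0 < i)
    (g : B → ℤ → A) (D : ℕ → Set B) (N : ℕ) :
    ∃ n₀ : ℕ, ∀ l ∈ listWords D 1, (∀ i ∈ (prodBy g u l).dom, 0 < i → (n₀ : ℤ) ≤ i) →
      l ∈ listWords D N := by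
  choose c hc hc0 using hpos
  refine ⟨∑ n ∈ Finset.range N, (c n).toNat + 1, fun l hl h => ⟨hl.1, hl.2.1, fun e he =>
    ⟨?_, (hl.2.2 e he).2⟩⟩⟩
  by_contra! hlt
  have h1 := h (c e.1) (mem_dom_prodBy.2 ⟨e, he, hc _⟩) (hc0 _)
  have h2 : (c e.1).toNat ≤ ∑ n ∈ Finset.range N, (c n).toNat :=
    Finset.single_le_sum (f := fun n => (c n).toNat) (fun _ _ => Nat.zero_le _)
      (Finset.mem_range.2 hlt)
  omega

end LocWord

/-! ### Words over positive and negative places -/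

namespace LocWord

variable {A : Type*}

/-- The pairs `(p, q)` that may replace the variable in the `n`-th word. The index `0`, which is
never used, is given the letters of the index `1`, so that the sets increase from `0` on. -/
def pairsAt (k : ℤ → ℕ) (n : ℕ) : Set (ℕ × ℕ) :=
  {b | (1 ≤ b.1 ∧ b.1 ≤ k ((max n 1 : ℕ) : ℤ)) ∧ 1 ≤ b.2 ∧ b.2 ≤ k (-((max n 1 : ℕ) : ℤ))}

/-- The indices `p` of the letters that may replace the variable in the `n`-th word. The index
`0`, which is never used, is given the letters of the index `1`, so that the sets increase from
`0` on. -/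
def lettersUpTo (k : ℤ → ℕ) (n : ℕ) : Set ℕ :=
  {p | 1 ≤ p ∧ p ≤ k ((max n 1 : ℕ) : ℤ)}

/-- The letters by which a pair `(p, q)` replaces the variable. -/
def pairLetter (α : ℤ → A) (b : ℕ × ℕ) (n : ℤ) : A :=
  if 0 < n then α (b.1 : ℤ) else α (-(b.2 : ℤ))

theorem prod₂_eq_prodBy (α : ℤ → A) (w : ℕ → LocWord A) (l : List (ℕ × Option (ℕ × ℕ))) :
    prod₂ α w l = prodBy (pairLetter α) w l := by
  unfold prod₂ prodBy
  congr 2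
  funext e
  rcases e with ⟨n, _ | b⟩ <;> rfl

theorem prod₁_eq_prodBy (α : ℤ → A) (w : ℕ → LocWord A) (l : List (ℕ × Option ℕ)) :
    prod₁ α w l = prodBy (fun (p : ℕ) _ => α (p : ℤ)) w l := by
  unfold prod₁ prodBy
  congr 2
  funext e
  rcases e with ⟨n, _ | b⟩ <;> rfl

theorem adm₂_iff {k : ℤ → ℕ} {l : List (ℕ × Option (ℕ × ℕ))} :
    Adm₂ k l ↔ l ∈ listWords (pairsAt k) 1 := by
  refine and_congr_right fun _ => and_congr_right fun _ => forall₂_congr fun e _ =>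
    and_congr_right fun h => ?_
  simp [Prod.forall, pairsAt, max_eq_left h, and_assoc]

theorem adm₁_iff {k : ℤ → ℕ} {l : List (ℕ × Option ℕ)} :
    Adm₁ k l ↔ l ∈ listWords (lettersUpTo k) 1 := by
  refine and_congr_right fun _ => and_congr_right fun _ => forall₂_congr fun e _ =>
    and_congr_right fun h => ?_
  simp [lettersUpTo, max_eq_left h]

theorem PosIncr.mono_max {f : ℕ → ℕ} (hf : PosIncr f) : Monotone fun n => f (max n 1) :=
  fun m _ h => hf.2 _ _ (le_max_right m 1) (max_le_max_right 1 h)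

theorem pairsAt_monotone {k : ℤ → ℕ} (hk : PosIncr fun n => k (n : ℤ))
    (hk' : PosIncr fun n => k (-(n : ℤ))) : Monotone (pairsAt k) :=
  fun _ _ h _ hb => ⟨⟨hb.1.1, hb.1.2.trans (hk.mono_max h)⟩, hb.2.1, hb.2.2.trans (hk'.mono_max h)⟩

theorem lettersUpTo_monotone {k : ℤ → ℕ} (hk : PosIncr fun n => k (n : ℤ)) :
    Monotone (lettersUpTo k) :=
  fun _ _ h _ hb => ⟨hb.1, hb.2.trans (hk.mono_max h)⟩

theorem lettersUpTo_finite (k : ℤ → ℕ) (n : ℕ) : (lettersUpTo k n).Finite :=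
  (Set.finite_Icc 1 (k ((max n 1 : ℕ) : ℤ)))

theorem pairsAt_finite (k : ℤ → ℕ) (n : ℕ) : (pairsAt k n).Finite :=
  (Set.finite_Icc 1 (k ((max n 1 : ℕ) : ℤ))).prod (Set.finite_Icc 1 (k (-((max n 1 : ℕ) : ℤ))))

theorem mem_lettersAt_of_pos {α : ℤ → A} {k : ℤ → ℕ} (hk : PosIncr fun n => k (n : ℤ)) {n p : ℕ}
    (hn : 1 ≤ n) (hp : 1 ≤ p) (hpn : p ≤ k ((max n 1 : ℕ) : ℤ)) {i : ℤ} (hi : (n : ℤ) ≤ i) :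
    α (p : ℤ) ∈ lettersAt α k i := by
  obtain ⟨m, rfl⟩ := Int.eq_ofNat_of_zero_le (by omega : 0 ≤ i)
  rw [max_eq_left hn] at hpn
  exact ⟨p, hp, hpn.trans (hk.2 n m hn (by omega)), Or.inl ⟨by omega, rfl⟩⟩

theorem mem_lettersAt_of_neg {α : ℤ → A} {k : ℤ → ℕ} (hk : PosIncr fun n => k (-(n : ℤ)))
    {n q : ℕ} (hn : 1 ≤ n) (hq : 1 ≤ q) (hqn : q ≤ k (-((max n 1 : ℕ) : ℤ))) {i : ℤ}
    (hi : i ≤ -(n : ℤ)) : α (-(q : ℤ)) ∈ lettersAt α k i := by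
  obtain ⟨m, hm⟩ := Int.eq_ofNat_of_zero_le (by omega : 0 ≤ -i)
  obtain rfl : i = -(m : ℤ) := by omega
  rw [max_eq_left hn] at hqn
  exact ⟨q, hq, hqn.trans (hk.2 n m hn (by omega)), Or.inr ⟨by omega, rfl⟩⟩

theorem exists_none_of_not_const {B : Type*} {l : List (ℕ × Option B)} (hl : l ∉ constLists B) :
    ∃ e ∈ l, e.2 = none := by
  simpa [constLists] using hl

theorem mem_dom_of_eq_some {w : LocWord A} {i : ℤ} {a : LSym A} (h : w.toFun i = some a) :
    i ∈ w.dom := by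
  simp [dom, h]

theorem exists_pos_of_mem_Lt0 {α : ℤ → A} {k : ℤ → ℕ} {w : LocWord A} (hw : w ∈ Lt0 α k) :
    ∃ i ∈ w.dom, 0 < i :=
  hw.2.2.elim fun i h => ⟨i, mem_dom_of_eq_some h.2, h.1⟩

theorem exists_neg_of_mem_Lt0 {α : ℤ → A} {k : ℤ → ℕ} {w : LocWord A} (hw : w ∈ Lt0 α k) :
    ∃ i ∈ w.dom, i < 0 :=
  hw.2.1.elim fun i h => ⟨i, mem_dom_of_eq_some h.2, h.1⟩

theorem expanding_of_mem_LtInf {α : ℤ → A} {k : ℤ → ℕ} {w : ℕ → LocWord A} (hw : w ∈ LtInf α k) :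
    Expanding w := by
  refine Expanding.of_succ (fun n hn => (hw n hn).1.1.2.1)
    (fun n hn => exists_pos_of_mem_Lt0 (hw n hn).1)
    (fun n hn _ _ _ => exists_neg_of_mem_Lt0 (hw n hn).1) fun n hn i hi j hj => ?_
  obtain ⟨A₁, A₂, -, -, hA, h₁, h₂⟩ := (hw n hn).2
  obtain ⟨a, ha, ha0⟩ := exists_pos_of_mem_Lt0 (hw n hn).1
  obtain ⟨b, hb, hb0⟩ := exists_neg_of_mem_Lt0 (hw n hn).1
  rw [hA] at hj
  rcases hj with hj | hj
  · have := h₁ j hj b hb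
    exact ⟨fun _ => by omega, fun _ => h₁ j hj i hi⟩
  · have := h₂ a ha j hj
    exact ⟨fun _ => h₂ i hi j hj, fun _ => by omega⟩

/-- A word that lies beyond `u` on both sides of `0` surrounds `u`. -/
theorem R1_of_beyond {u v : LocWord A} (h0 : (0 : ℤ) ∉ v.dom) (hpos : ∃ i ∈ v.dom, 0 < i)
    (hneg : ∃ i ∈ v.dom, i < 0)
    (h : ∀ i ∈ u.dom, ∀ j ∈ v.dom, (0 < j → i < j) ∧ (j < 0 → j < i)) : R1 u v := by
  refine ⟨{i ∈ v.dom | i < 0}, {i ∈ v.dom | 0 < i}, hneg, hpos, ?_,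
    fun j hj i hi => (h i hi j hj.1).2 hj.2, fun i hi j hj => (h i hi j hj.1).1 hj.2⟩
  ext i
  refine ⟨fun hi => ?_, fun hi => hi.elim (fun h => h.1) fun h => h.1⟩
  rcases lt_trichotomy i 0 with h | h | h
  · exact Or.inl ⟨hi, h⟩
  · exact absurd (h ▸ hi) h0
  · exact Or.inr ⟨hi, h⟩

/-- The limit theorem for words with positive and negative places. -/
theorem exists_extraction₂_limit {X : Type*} [MetricSpace X] [CompactSpace X] {α : ℤ → A}
    {k : ℤ → ℕ} (hk : PosIncr fun n => k (n : ℤ)) (hk' : PosIncr fun n => k (-(n : ℤ)))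
    {T : LocWord A → X → X} (hT : IsLtSystem α k T) {w : ℕ → LocWord A} (hw : w ∈ LtInf α k)
    (x : X) : ∃ (u : ℕ → LocWord A) (x₀ : X), Extraction₂ α k u w ∧
      R1Lim (Et α k u) (fun z => T z x) x₀ ∧ R1Lim (Et α k u) (fun z => T z x₀) x₀ := by
  have hexp := expanding_of_mem_LtInf hw
  have hposw : ∀ n, 1 ≤ n → ∃ i ∈ (w n).dom, 0 < i :=
    fun n hn => exists_pos_of_mem_Lt0 (hw n hn).1
  have hnegw : ∀ n, 1 ≤ n → ∃ i ∈ (w n).dom, i < 0 :=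
    fun n hn => exists_neg_of_mem_Lt0 (hw n hn).1
  have hall : ∀ n, 1 ≤ n → w n ∈ LtAll α k := fun n hn => (hw n hn).1.1
  have hg : ∀ n, 1 ≤ n → ∀ b ∈ pairsAt k n, ∀ i ∈ (w n).dom,
      pairLetter α b i ∈ lettersAt α k i := by
    intro n hn b hb i hi
    obtain ⟨hp, hq⟩ := index_le_abs hexp hposw (fun n hn _ _ _ => hnegw n hn) hn i hi
    have h0 : i ≠ 0 := fun h => hexp.1 n hn (h ▸ hi)
    by_cases h : 0 < i
    · rw [pairLetter, if_pos h]
      exact mem_lettersAt_of_pos hk hn hb.1.1 hb.1.2 (hp h)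
    · rw [pairLetter, if_neg h]
      exact mem_lettersAt_of_neg hk' hn hb.2.1 hb.2.2 (hq (by omega))
  have hposl : ∀ l ∈ listWords (pairsAt k) 1, ∃ i ∈ (prodBy (pairLetter α) w l).dom, 0 < i := by
    intro l hl
    obtain ⟨e, he⟩ := List.exists_mem_of_ne_nil l hl.1
    obtain ⟨i, hi, hi0⟩ := hposw e.1 (hl.2.2 e he).1
    exact ⟨i, mem_dom_prodBy.2 ⟨e, he, hi⟩, hi0⟩
  have hnegl : ∀ l ∈ listWords (pairsAt k) 1, ∃ i ∈ (prodBy (pairLetter α) w l).dom, i < 0 := by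
    intro l hl
    obtain ⟨e, he⟩ := List.exists_mem_of_ne_nil l hl.1
    obtain ⟨i, hi, hi0⟩ := hnegw e.1 (hl.2.2 e he).1
    exact ⟨i, mem_dom_prodBy.2 ⟨e, he, hi⟩, hi0⟩
  have hR1 : ∀ l ∈ listWords (pairsAt k) 1, ∀ l' ∈ listWords (pairsAt k) 1,
      (∀ e ∈ l, ∀ e' ∈ l', e.1 < e'.1) →
      R1 (prodBy (pairLetter α) w l) (prodBy (pairLetter α) w l') := fun l hl l' hl' h =>
    R1_of_beyond (prodBy_mem_LtAll hall hg hl').2.1 (hposl l' hl') (hnegl l' hl')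
      fun _ hi _ hj => hexp.prodBy_lt hl h hi hj
  obtain ⟨s, x₀, hs, hsv, hlt, hlim⟩ := exists_sequence_limit (pairsAt_monotone hk hk')
    ⟨(1, 1), ⟨le_rfl, hk.1 1 le_rfl⟩, le_rfl, hk'.1 1 le_rfl⟩ (pairsAt_finite k) 1
    (fun l => T (prodBy (pairLetter α) w l))
    (fun l hl hlc => hT.1 _ (prodBy_mem_Lt hall hg hl hlc))
    (fun l hl hlc l' hl' hlc' h => by
      rw [prodBy_append]
      exact hT.2 _ (prodBy_mem_Lt hall hg hl hlc) _ (prodBy_mem_Lt hall hg hl' hlc')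
        (hR1 l hl l' hl' h)) x
  have hu0 : ∀ n, prodBy (pairLetter α) w (s n) ∈ Lt0 α k := by
    intro n
    obtain ⟨⟨m, c⟩, he, rfl⟩ := exists_none_of_not_const (hsv n)
    have hm := ((hs n).2.2 _ he).1
    have hvar : ∀ i, (w m).toFun i = some LSym.var →
        (prodBy (pairLetter α) w (s n)).toFun i = some LSym.var := fun i hi =>
      (hexp.prodBy_apply _ (hs n) he (mem_dom_of_eq_some hi)).trans hi
    obtain ⟨-, ⟨i, hi0, hi⟩, j, hj0, hj⟩ := (hw m hm).1
    exact ⟨prodBy_mem_LtAll hall hg (hs n), ⟨i, hi0, hvar i hi⟩, j, hj0, hvar j hj⟩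
  refine ⟨fun n => prodBy (pairLetter α) w (s n), x₀, ⟨fun n _ => ⟨hu0 n, ?_⟩,
    fun n _ => ⟨hu0 n, s n, adm₂_iff.2 (hs n), exists_none_of_not_const (hsv n),
      (prod₂_eq_prodBy α w (s n)).symm⟩⟩, ?_⟩
  · exact hR1 _ (hs n) _ (hs (n + 1)) (hlt n (n + 1) n.lt_succ_self)
  · have key : ∀ V ∈ 𝓝 x₀, ∃ n₀ : ℕ, ∀ z ∈ Et α k fun n => prodBy (pairLetter α) w (s n),
        Far₂ n₀ z → T z x ∈ V ∧ T z x₀ ∈ V := by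
      intro V hV
      obtain ⟨N, hN⟩ := hlim V hV
      obtain ⟨n₀, hn₀⟩ := exists_far_bound (fun n => hposl (s n) (hs n)) (pairLetter α)
        (pairsAt k) N
      refine ⟨n₀, ?_⟩
      rintro _ ⟨-, l, hl, hlc, rfl⟩ hfar
      rw [prod₂_eq_prodBy] at hfar ⊢
      rw [← prodBy_extractList]
      exact hN l (hn₀ l (adm₂_iff.1 hl) fun i hi => (hfar.2.2 i hi).2) hlc
    exact ⟨fun V hV => (key V hV).imp fun _ h z hz hf => (h z hz hf).1,
      fun V hV => (key V hV).imp fun _ h z hz hf => (h z hz hf).2⟩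

/-! ### Words over positive places -/

theorem exists_pos_of_mem_LpVar {α : ℤ → A} {k : ℤ → ℕ} {w : LocWord A} (hw : w ∈ LpVar α k) :
    ∃ i ∈ w.dom, 0 < i :=
  hw.1.1.elim fun i h => ⟨i, h, hw.2.1 i h⟩

theorem expanding_of_mem_LpInf {α : ℤ → A} {k : ℤ → ℕ} {w : ℕ → LocWord A} (hw : w ∈ LpInf α k) :
    Expanding w := by
  refine Expanding.of_succ (fun n hn => (hw n hn).1.1.2.1)
    (fun n hn => exists_pos_of_mem_LpVar (hw n hn).1)
    (fun n _ j hj hj0 => ?_) fun n hn i hi j hj => ⟨fun _ => (hw n hn).2 i hi j hj, fun hj0 => ?_⟩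
  all_goals exact absurd ((hw (n + 1) n.succ_pos).1.2.1 j hj) hj0.not_gt

/-- The limit theorem for words with positive places. -/
theorem exists_extraction₁_limit {X : Type*} [MetricSpace X] [CompactSpace X] {α : ℤ → A}
    {k : ℤ → ℕ} (hk : PosIncr fun n => k (n : ℤ))
    {T : LocWord A → X → X} (hT : IsLpSystem α k T) {w : ℕ → LocWord A} (hw : w ∈ LpInf α k)
    (x : X) : ∃ (u : ℕ → LocWord A) (x₀ : X), Extraction₁ α k u w ∧
      R2Lim (Ep α k u) (fun z => T z x) x₀ ∧ R2Lim (Ep α k u) (fun z => T z x₀) x₀ := by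
  let g : ℕ → ℤ → A := fun p _ => α (p : ℤ)
  have hexp := expanding_of_mem_LpInf hw
  have hposw : ∀ n, 1 ≤ n → ∃ i ∈ (w n).dom, 0 < i :=
    fun n hn => exists_pos_of_mem_LpVar (hw n hn).1
  have hall : ∀ n, 1 ≤ n → w n ∈ LtAll α k := fun n hn => (hw n hn).1.1
  have hg : ∀ n, 1 ≤ n → ∀ b ∈ lettersUpTo k n, ∀ i ∈ (w n).dom, g b i ∈ lettersAt α k i := by
    intro n hn b hb i hi
    have h := index_le_abs hexp hposw
      (fun n _ j hj hj0 => absurd ((hw (n + 1) n.succ_pos).1.2.1 j hj) hj0.not_gt) hn i hi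
    exact mem_lettersAt_of_pos hk hn hb.1 hb.2 (h.1 ((hw n hn).1.2.1 i hi))
  have hpos : ∀ l ∈ listWords (lettersUpTo k) 1, ∀ i ∈ (prodBy g w l).dom, 0 < i := by
    intro l hl i hi
    obtain ⟨e, he, hi⟩ := mem_dom_prodBy.1 hi
    exact (hw e.1 (hl.2.2 e he).1).1.2.1 i hi
  have hLp : ∀ l ∈ listWords (lettersUpTo k) 1, l ∈ constLists ℕ → prodBy g w l ∈ Lp α k :=
    fun l hl hlc => ⟨prodBy_mem_Lt hall hg hl hlc, hpos l hl⟩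
  have hR2 : ∀ l ∈ listWords (lettersUpTo k) 1, ∀ l' ∈ listWords (lettersUpTo k) 1,
      (∀ e ∈ l, ∀ e' ∈ l', e.1 < e'.1) → R2 (prodBy g w l) (prodBy g w l') :=
    fun l hl l' hl' h i hi j hj => (hexp.prodBy_lt hl h hi hj).1 (hpos l' hl' j hj)
  obtain ⟨s, x₀, hs, hsv, hlt, hlim⟩ := exists_sequence_limit (lettersUpTo_monotone hk)
    ⟨1, le_rfl, hk.1 1 le_rfl⟩ (lettersUpTo_finite k) 1 (fun l => T (prodBy g w l))
    (fun l hl hlc => hT.1 _ (hLp l hl hlc))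
    (fun l hl hlc l' hl' hlc' h => by
      rw [prodBy_append]
      exact hT.2 _ (hLp l hl hlc) _ (hLp l' hl' hlc') (hR2 l hl l' hl' h)) x
  have huv : ∀ n, prodBy g w (s n) ∈ LpVar α k := by
    intro n
    obtain ⟨⟨m, c⟩, he, rfl⟩ := exists_none_of_not_const (hsv n)
    obtain ⟨-, -, i, hi⟩ := (hw m ((hs n).2.2 _ he).1).1
    exact ⟨prodBy_mem_LtAll hall hg (hs n), hpos _ (hs n), i,
      (hexp.prodBy_apply g (hs n) he (mem_dom_of_eq_some hi)).trans hi⟩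
  refine ⟨fun n => prodBy g w (s n), x₀, ⟨fun n _ => ⟨huv n, ?_⟩,
    fun n _ => ⟨huv n, s n, adm₁_iff.2 (hs n), exists_none_of_not_const (hsv n),
      (prod₁_eq_prodBy α w (s n)).symm⟩⟩, ?_⟩
  · exact hR2 _ (hs n) _ (hs (n + 1)) (hlt n (n + 1) n.lt_succ_self)
  · have key : ∀ V ∈ 𝓝 x₀, ∃ n₀ : ℕ, ∀ z ∈ Ep α k fun n => prodBy g w (s n),
        Far₁ n₀ z → T z x ∈ V ∧ T z x₀ ∈ V := by
      intro V hV
      obtain ⟨N, hN⟩ := hlim V hV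
      obtain ⟨n₀, hn₀⟩ := exists_far_bound (fun n => exists_pos_of_mem_LpVar (huv n)) g
        (lettersUpTo k) N
      refine ⟨n₀, ?_⟩
      rintro _ ⟨-, l, hl, hlc, rfl⟩ hfar
      rw [prod₁_eq_prodBy] at hfar ⊢
      rw [← prodBy_extractList]
      exact hN l (hn₀ l (adm₁_iff.1 hl) fun i hi _ => hfar i hi) hlc
    exact ⟨fun V hV => (key V hV).imp fun _ h z hz hf => (h z hz hf).1,
      fun V hV => (key V hV).imp fun _ h z hz hf => (h z hz hf).2⟩

end LocWord

theorem theorem5 {A X : Type*} [MetricSpace X] [CompactSpace X] (α : ℤ → A) (k : ℤ → ℕ)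
    (hk : LocWord.PosIncr (fun n => k (n : ℤ))) (T : LocWord A → X → X)
    (w : ℕ → LocWord A) (x : X) :
    (LocWord.PosIncr (fun n => k (-(n : ℤ))) → LocWord.IsLtSystem α k T → w ∈ LocWord.LtInf α k →
      ∃ (u : ℕ → LocWord A) (x₀ : X), LocWord.Extraction₂ α k u w ∧
        LocWord.R1Lim (LocWord.Et α k u) (fun z => T z x) x₀ ∧
        LocWord.R1Lim (LocWord.Et α k u) (fun z => T z x₀) x₀) ∧
    (LocWord.IsLpSystem α k T → w ∈ LocWord.LpInf α k →
      ∃ (u : ℕ → LocWord A) (x₀ : X), LocWord.Extraction₁ α k u w ∧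
        LocWord.R2Lim (LocWord.Ep α k u) (fun z => T z x) x₀ ∧
        LocWord.R2Lim (LocWord.Ep α k u) (fun z => T z x₀) x₀) :=
  ⟨fun hk' hT hw => LocWord.exists_extraction₂_limit hk hk' hT hw x,
    fun hT hw => LocWord.exists_extraction₁_limit hk hT hw x⟩
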